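/- **Proposition (Inverse GLA).** Let $\mathscr F$ be a complex vector space with the Hausdorff locally convex topology generated by a separating family of seminorms; assume that $\mathscr F$ is separable and locally sequentially weakly compact (every bounded sequence in $\mathscr F$ has a subsequence converging weakly to an element of $\mathscr F$). Let $(\mathscr S,\Sigma,\mu)$ be an equicontinuous spectral measure triple on $\mathscr F$: $\mu$ maps the $\sigma$-algebra $\Sigma$ of subsets of $\mathscr S$ into the continuous linear operators on $\mathscr F$, is countably additive in the weak operator topology, satisfies $\mu(\mathscr S)=I$ and $\mu(A_1\cap A_2)=\mu(A_1)\mu(A_2)$, and for every continuous seminorm $p$ there is a continuous seminorm $q$ with $p(\mu(A)\psi)\le q(\psi)$ for all $A\in\Sigma$, $\psi\in\mathscr F$. Let $f:\mathscr S\to\mathbb C$ be bounded and $\Sigma$-measurable, $U=\int_{\mathscr S} f\,d\mu$ (the strong limit of the integrals of simple functions converging uniformly to $f$), and $E(B)=\mu(f^{-1}(B))$ for Borel sets $B\subseteq\mathbb C$. The spectrum $\sigma(U)$ is the complement of the set of $\xi\in\mathbb C$ for which $\xi I-U$ has dense image and is injective with continuous inverse on its image; the point spectrum $\sigma_p(U)$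 is the set of $\xi\in\sigma(U)$ for which $\xi I-U$ is not injective. For $r>0$ let $\mathbb D_r=\{|z|<r\}$. Assume that: 1. ($U$ has minimal point spectrum.) With $\sigma'=\{\xi^{-1}:\xi\in\sigma(U)\}$ and $\sigma_p'=\{\xi^{-1}:\xi\in\sigma_p(U)\}$ there is $R>0$ such that $\sigma'\setminus\mathbb D_R\ne\emptyset$ and for every $r>R$: if $\mathbb D_r\cap\sigma_p'\neq\emptyset$, then some $\eta\in\mathbb D_r\cap\sigma'$ satisfies $|\eta|=\sup\{|\zeta|:\zeta\in\mathbb D_r\cap\sigma'\}$; and $\sigma'\setminus\mathbb D_r\subseteq\sigma'_p$. 2. (The point spectrum is concentrated on isolated circles.) Every point of the set $\{|f(s)| : s\in\mathscr S,\ f(s)I-U\text{ is not injective}\}\subset\mathbb R$ is an isolated point of this set. 3. There is a constant $C>0$ with $|\xi|\ge C^{-1}$ for all $\xi\in\sigma(U)$. Then $U$ has a continuous inverse $U^{-1}$ on $\mathscr F$, and for every $\lambda\in\sigma_p(U)$ $$E(\{\lambda\})=\lim_{n\to\infty}A_n\bigl(\lambda U^{-1}(I-E(\Omega))\bigr),\qquad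 A_n(V)=\frac1n\sum_{k=0}^{n-1}V^k,$$ in the strong operator topology, where $\Omega=\{\xi\in\sigma(U):|\xi|<|\lambda|\}$. Here $E$ is regarded as a measure on $\sigma(U)$: $E(\Omega)$ means $E(B)$ for any Borel set $B\subseteq\mathbb C$ with $B\cap\sigma(U)=\Omega$ (for instance $B=\mathbb D_{|\lambda|}$, or $B=\Omega$ if $\Omega$ is Borel), and the assertion holds for every such $B$. -/

import Mathlib

open Filter Topology

/-- A spectral measure triple `(S, Σ, μ)` on `F`: a set function from the `σ`-algebra `Σ` of `S`
to the continuous linear operators on `F` that is countably additive in the weak operator topology,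
normalised by `μ(S) = I` and multiplicative on intersections.  (Values on non-measurable sets play
no role.) -/
structure SpectralMeasure (S F : Type*) [MeasurableSpace S] [AddCommGroup F] [Module ℂ F]
    [TopologicalSpace F] where
  toFun : Set S → F →L[ℂ] F
  countably_additive : ∀ A : ℕ → Set S, (∀ i, MeasurableSet (A i)) →
    Pairwise (fun i j => Disjoint (A i) (A j)) →
    ∀ (x : F) (φ : F →L[ℂ] ℂ), HasSum (fun i => φ (toFun (A i) x)) (φ (toFun (⋃ i, A i) x))
  map_univ : toFun Set.univ = ContinuousLinearMap.id ℂ F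
  map_inter : ∀ A B : Set S, MeasurableSet A → MeasurableSet B →
    toFun (A ∩ B) = (toFun A).comp (toFun B)

namespace SpectralMeasure

variable {S T F : Type*} [MeasurableSpace S] [MeasurableSpace T] [AddCommGroup F] [Module ℂ F]
  [TopologicalSpace F]

instance : CoeFun (SpectralMeasure S F) (fun _ => Set S → F →L[ℂ] F) := ⟨SpectralMeasure.toFun⟩

/-- The operators `μ(A)`, `A ∈ Σ`, form an equicontinuous family. -/
def IsEquicontinuous (μ : SpectralMeasure S F) : Prop :=
  ∀ p : Seminorm ℂ F, Continuous p → ∃ q : Seminorm ℂ F, Continuous q ∧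
    ∀ A : Set S, MeasurableSet A → ∀ x : F, p (μ A x) ≤ q x

/-- Change of measure: the spectral measure `B ↦ μ(f⁻¹(B))`. -/
def map (μ : SpectralMeasure S F) (f : S → T) (hf : Measurable f) : SpectralMeasure T F where
  toFun B := μ (f ⁻¹' B)
  countably_additive A hA hd x φ := by
    have h := μ.countably_additive (fun i => f ⁻¹' A i) (fun i => hf (hA i))
      (fun i j hij => (hd hij).preimage f) x φ
    simpa only [Set.preimage_iUnion] using h
  map_univ := by simpa only [Set.preimage_univ] using μ.map_univ
  map_inter A B hA hB := by
    simpa only [Set.preimage_inter] using μ.map_inter _ _ (hf hA) (hf hB)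

variable [IsTopologicalAddGroup F] [ContinuousSMul ℂ F]

/-- The integral `∑ c, c • μ(g = c)` of a simple function. -/
noncomputable def simpleIntegral (μ : SpectralMeasure S F) (g : MeasureTheory.SimpleFunc S ℂ) :
    F →L[ℂ] F :=
  ∑ c ∈ g.range, c • μ (g ⁻¹' {c})

/-- `U = ∫ f dμ`: the operator `U` is the strong limit of the integrals of simple functions that
converge uniformly to `f`.  (For an equicontinuous `μ` the limit does not depend on the sequence of
simple functions, and it exists for all bounded measurable `f` if `F` is sequentially complete.) -/
def HasIntegral (μ : SpectralMeasure S F) (f : S → ℂ) (U : F →L[ℂ] F) : Prop :=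
  ∃ g : ℕ → MeasureTheory.SimpleFunc S ℂ, TendstoUniformly (fun n s => g n s) f atTop ∧
    ∀ x : F, Tendsto (fun n => μ.simpleIntegral (g n) x) atTop (𝓝 (U x))

end SpectralMeasure

/-- Local sequential weak compactness: every bounded sequence has a subsequence that converges
weakly to an element of the space. -/
def LocallySeqWeaklyCompact (F : Type*) [AddCommGroup F] [Module ℂ F] [TopologicalSpace F] : Prop :=
  ∀ x : ℕ → F, Bornology.IsVonNBounded ℂ (Set.range x) →
    ∃ (y : F) (k : ℕ → ℕ), StrictMono k ∧
      ∀ φ : F →L[ℂ] ℂ, Tendsto (fun n => φ (x (k n))) atTop (𝓝 (φ y))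

section Spectrum

variable {F : Type*} [AddCommGroup F] [Module ℂ F] [TopologicalSpace F] [IsTopologicalAddGroup F]
  [ContinuousSMul ℂ F]

/-- The operator `ξ I - U`. -/
def shiftedOp (U : F →L[ℂ] F) (ξ : ℂ) : F →L[ℂ] F :=
  ξ • ContinuousLinearMap.id ℂ F - U

/-- The resolvent set: all `ξ` for which `ξ I - U` has dense image and a continuous inverse on its
image (it is injective, and a homeomorphism onto its image). -/
def lcResolventSet (U : F →L[ℂ] F) : Set ℂ :=
  {ξ | DenseRange (shiftedOp U ξ) ∧ IsEmbedding (shiftedOp U ξ)}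

/-- The spectrum `σ(U)`. -/
def lcSpectrum (U : F →L[ℂ] F) : Set ℂ := (lcResolventSet U)ᶜ

/-- The point spectrum `σ_p(U)`: the points of the spectrum for which `ξ I - U` has no inverse,
that is, is not injective. -/
def pointSpectrum (U : F →L[ℂ] F) : Set ℂ :=
  {ξ ∈ lcSpectrum U | ¬ Function.Injective (shiftedOp U ξ)}

/-- The elements of `A` whose modulus equals `sup_{ξ ∈ A} |ξ|`. -/
def peripheralPart (A : Set ℂ) : Set ℂ :=
  {ξ ∈ A | IsLUB ((fun z : ℂ => ‖z‖) '' A) ‖ξ‖}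

/-- A spectrum `σ` with set of eigenvalues `σp` has dominating point spectrum. -/
def HasDominatingPointSpectrum (σ σp : Set ℂ) : Prop :=
  ∃ R : ℝ, 0 < R ∧ (σ \ Metric.ball 0 R).Nonempty ∧ ∀ r : ℝ, R < r →
    ((Metric.ball 0 r ∩ σ ∩ σp).Nonempty → (peripheralPart (Metric.ball 0 r ∩ σ)).Nonempty) ∧
    σ \ Metric.ball 0 r ⊆ σp

/-- `U` has minimal point spectrum: the inverted spectrum `{ξ⁻¹ | ξ ∈ σ(U)}`, whose eigenvalues are
the inverses of the eigenvalues of `U`, is dominating.  Only used for `0 ∉ σ(U)`, so that no point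
is inverted to infinity. -/
def HasMinimalPointSpectrum (U : F →L[ℂ] F) : Prop :=
  HasDominatingPointSpectrum ((fun ξ : ℂ => ξ⁻¹) '' lcSpectrum U)
    ((fun ξ : ℂ => ξ⁻¹) '' pointSpectrum U)

/-- The point spectrum of `U = ∫ f dμ` is concentrated on isolated circles: every point of the set
of all moduli `|f(s)|` for which `f(s) I - U` has no inverse is an isolated point of that set. -/
def PointSpectrumOnIsolatedCircles {S : Type*} (f : S → ℂ) (U : F →L[ℂ] F) : Prop :=
  ∀ r ∈ {r : ℝ | ∃ s : S, ‖f s‖ = r ∧ ¬ Function.Injective (shiftedOp U (f s))},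
    ¬ AccPt r (𝓟 {r : ℝ | ∃ s : S, ‖f s‖ = r ∧ ¬ Function.Injective (shiftedOp U (f s))})

/-- The averages `A_n(V) = n⁻¹ ∑_{k=0}^{n-1} V^k`. -/
noncomputable def averageOp (n : ℕ) (V : F →L[ℂ] F) : F →L[ℂ] F :=
  (n : ℂ)⁻¹ • ∑ k ∈ Finset.range n, V ^ k

end Spectrum

/-! The operator `λ U⁻¹(I - E(Ω))` is an integral `∫ w dμ` with `w = λ / f` where `|f| ≥ |λ|` and `w
= 0` elsewhere. Since `|w| ≤ 1`, the averages of the powers of `w` are bounded by 1 and converge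
pointwise to the indicator of `{w = 1} = {f = λ}`. Multiplicativity of the integral and bounded
convergence in the strong topology (`tendsto_zero_of_hasIntegral`) turn this into the claim.

Two facts make `1 / f` available. First, `E` vanishes on Borel subsets of the resolvent set
(`apply_preimage_eq_zero`), so `|f| ≥ C⁻¹` up to a `μ`-null set. The resolvent estimates depend on
the point, without uniformity; a differentiation theorem for measures on the plane replaces a
covering argument. Second, `U` is onto (`surjective_of_hasIntegral`): simple approximations of `1 /
f` give bounded approximate preimages, and weak compactness supplies a preimage. -/

section LocallyConvex

/-! ### Seminorms, Hahn–Banach separation and weak limits. -/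

variable {F : Type*} [AddCommGroup F] [Module ℂ F] [TopologicalSpace F]

theorem tendsto_iff_forall_continuous_seminorm [PolynormableSpace ℂ F] {ι : Type*} {L : Filter ι}
    {u : ι → F} {y : F} :
    Tendsto u L (𝓝 y) ↔
      ∀ p : Seminorm ℂ F, Continuous p → Tendsto (fun i => p (u i - y)) L (𝓝 0) := by
  rw [(PolynormableSpace.withSeminorms ℂ F).tendsto_nhds]
  constructor
  · intro h p hp
    rw [Metric.tendsto_nhds]
    intro ε hε
    filter_upwards [h ⟨p, hp⟩ ε hε] with i hi
    simpa [abs_of_nonneg (apply_nonneg p _)] using hi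
  · intro h p ε hε
    exact (h p.1 p.2).eventually (gt_mem_nhds hε)

theorem locallyConvexSpace_real [PolynormableSpace ℂ F] : LocallyConvexSpace ℝ F :=
  (PolynormableSpace.withSeminorms ℂ F).toLocallyConvexSpace

variable [IsTopologicalAddGroup F] [ContinuousSMul ℂ F] [PolynormableSpace ℂ F]

theorem eq_of_forall_re_dual_eq [T2Space F] {x y : F} (h : ∀ φ : F →L[ℂ] ℂ, (φ x).re = (φ y).re) :
    x = y := by
  have := locallyConvexSpace_real (F := F)
  by_contra hxy
  obtain ⟨φ, hφ⟩ := RCLike.geometric_hahn_banach_point_point (𝕜 := ℂ) hxy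
  exact hφ.ne (h φ)

theorem eq_of_forall_dual_eq [T2Space F] {x y : F} (h : ∀ φ : F →L[ℂ] ℂ, φ x = φ y) : x = y :=
  eq_of_forall_re_dual_eq fun φ => by rw [h φ]

theorem mem_closed_submodule_of_weak_limit {M : Submodule ℂ F} (hM : IsClosed (M : Set F))
    {u : ℕ → F} (hu : ∀ n, u n ∈ M) {x : F}
    (hx : ∀ φ : F →L[ℂ] ℂ, Tendsto (fun n => φ (u n)) atTop (𝓝 (φ x))) : x ∈ M := by
  have := locallyConvexSpace_real (F := F)
  by_contra hxM
  obtain ⟨φ, c, hφ, hc⟩ := RCLike.geometric_hahn_banach_closed_point (𝕜 := ℂ)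
    (M.restrictScalars ℝ).convex hM hxM
  have h := (Complex.continuous_re.tendsto _).comp (hx φ)
  exact absurd (le_of_tendsto h (Eventually.of_forall fun n => (hφ _ (hu n)).le)) (not_le.2 hc)

end LocallyConvex

/-! ### Seminorm bounds for linear combinations from bounds on subset sums. -/

section ConvexBounds

variable {F ι : Type*} [AddCommGroup F] [Module ℂ F]

/-- Combinations with coefficients in `[0, 1]` lie in the convex hull of the subset sums. The
induction splits off one index as a convex combination of "without `v j`" and "with `v j`"; the
offset `a` absorbs the latter. -/
theorem Seminorm.add_sum_smul_le_of_subset_sums (p : Seminorm ℂ F) (v : ι → F) (t : ι → ℝ) {M : ℝ}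
    (s : Finset ι) (ht : ∀ i ∈ s, t i ∈ Set.Icc (0 : ℝ) 1) (a : F)
    (h : ∀ I ⊆ s, p (a + ∑ i ∈ I, v i) ≤ M) : p (a + ∑ i ∈ s, (t i : ℂ) • v i) ≤ M := by
  classical
  induction s using Finset.induction_on generalizing a with
  | empty => simpa using h ∅ (by simp)
  | insert j s hj ih =>
    have h1 := ih (fun i hi => ht i (Finset.mem_insert_of_mem hi)) a
      (fun I hI => h I (hI.trans (Finset.subset_insert _ _)))
    have h2 := ih (fun i hi => ht i (Finset.mem_insert_of_mem hi)) (a + v j) (fun I hI => by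
      have := h (insert j I) (Finset.insert_subset_insert _ hI)
      rwa [Finset.sum_insert (fun h => hj (hI h)), ← add_assoc] at this)
    obtain ⟨h0, h1'⟩ := ht j (Finset.mem_insert_self _ _)
    have e : a + ∑ i ∈ insert j s, (t i : ℂ) • v i =
        ((1 - t j : ℝ) : ℂ) • (a + ∑ i ∈ s, (t i : ℂ) • v i) +
          (t j : ℂ) • (a + v j + ∑ i ∈ s, (t i : ℂ) • v i) := by
      rw [Finset.sum_insert hj]
      push_cast
      module
    rw [e]
    refine (map_add_le_add p _ _).trans ?_
    rw [map_smul_eq_mul, map_smul_eq_mul, Complex.norm_real, Complex.norm_real,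
      Real.norm_of_nonneg (by linarith), Real.norm_of_nonneg h0]
    nlinarith [mul_le_mul_of_nonneg_left h1 (by linarith : 0 ≤ 1 - t j),
      mul_le_mul_of_nonneg_left h2 h0]

theorem Seminorm.sum_real_smul_le (p : Seminorm ℂ F) (v : ι → F) (t : ι → ℝ) {K M : ℝ}
    (hK : 0 < K) (s : Finset ι) (ht : ∀ i ∈ s, t i ∈ Set.Icc (0 : ℝ) K)
    (h : ∀ I ⊆ s, p (∑ i ∈ I, v i) ≤ M) : p (∑ i ∈ s, (t i : ℂ) • v i) ≤ K * M := by
  have h1 := p.add_sum_smul_le_of_subset_sums v (fun i => t i / K) s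
    (fun i hi => ⟨div_nonneg (ht i hi).1 hK.le, (div_le_one hK).2 (ht i hi).2⟩) 0
    (M := M) (by simpa using h)
  have e : ∑ i ∈ s, (t i : ℂ) • v i = (K : ℂ) • (0 + ∑ i ∈ s, ((t i / K : ℝ) : ℂ) • v i) := by
    rw [zero_add, Finset.smul_sum]
    refine Finset.sum_congr rfl fun i _ => ?_
    rw [smul_smul]
    congr 1
    have : (K : ℂ) ≠ 0 := by exact_mod_cast hK.ne'
    push_cast
    field_simp
  rw [e, map_smul_eq_mul, Complex.norm_real, Real.norm_of_nonneg hK.le]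
  exact mul_le_mul_of_nonneg_left h1 hK.le

/-- The factor 4 counts the positive and negative parts of the real and imaginary parts. -/
theorem Seminorm.sum_complex_smul_le (p : Seminorm ℂ F) (v : ι → F) (c : ι → ℂ) {K M : ℝ}
    (hK : 0 < K) (s : Finset ι) (hc : ∀ i ∈ s, ‖c i‖ ≤ K)
    (h : ∀ I ⊆ s, p (∑ i ∈ I, v i) ≤ M) : p (∑ i ∈ s, c i • v i) ≤ 4 * K * M := by
  have hb (u : ℂ → ℝ) (hu : ∀ z, |u z| ≤ ‖z‖) :
      p (∑ i ∈ s, ((max (u (c i)) 0 : ℝ) : ℂ) • v i) ≤ K * M :=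
    p.sum_real_smul_le v _ hK s (fun i hi => ⟨le_max_right _ _,
      max_le ((le_abs_self _).trans ((hu _).trans (hc i hi))) hK.le⟩) h
  have h1 := hb (fun z => z.re) Complex.abs_re_le_norm
  have h2 := hb (fun z => -z.re) (fun z => by simpa using Complex.abs_re_le_norm z)
  have h3 := hb (fun z => z.im) Complex.abs_im_le_norm
  have h4 := hb (fun z => -z.im) (fun z => by simpa using Complex.abs_im_le_norm z)
  have hmax (a : ℝ) : max a 0 - max (-a) 0 = a := by
    rcases le_total a 0 with h | h
    · rw [max_eq_right h, max_eq_left (by linarith)]; ring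
    · rw [max_eq_left h, max_eq_right (by linarith)]; ring
  have e : ∑ i ∈ s, c i • v i =
      (∑ i ∈ s, ((max (c i).re 0 : ℝ) : ℂ) • v i - ∑ i ∈ s, ((max (-(c i).re) 0 : ℝ) : ℂ) • v i) +
      Complex.I • (∑ i ∈ s, ((max (c i).im 0 : ℝ) : ℂ) • v i -
        ∑ i ∈ s, ((max (-(c i).im) 0 : ℝ) : ℂ) • v i) := by
    rw [← Finset.sum_sub_distrib, ← Finset.sum_sub_distrib, Finset.smul_sum,
      ← Finset.sum_add_distrib]
    refine Finset.sum_congr rfl fun i _ => ?_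
    rw [← sub_smul, ← sub_smul, smul_smul, ← add_smul, ← Complex.ofReal_sub, ← Complex.ofReal_sub,
      hmax, hmax, mul_comm Complex.I, Complex.re_add_im]
  rw [e]
  refine (map_add_le_add p _ _).trans ?_
  rw [map_smul_eq_mul, Complex.norm_I, one_mul]
  have h5 := map_sub_le_add p (∑ i ∈ s, ((max (c i).re 0 : ℝ) : ℂ) • v i)
    (∑ i ∈ s, ((max (-(c i).re) 0 : ℝ) : ℂ) • v i)
  have h6 := map_sub_le_add p (∑ i ∈ s, ((max (c i).im 0 : ℝ) : ℂ) • v i)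
    (∑ i ∈ s, ((max (-(c i).im) 0 : ℝ) : ℂ) • v i)
  linarith

end ConvexBounds

/-! ### Scalar measures, finite additivity and integrals of simple functions. -/

namespace SpectralMeasure

open MeasureTheory

variable {S F : Type*} [MeasurableSpace S] [AddCommGroup F] [Module ℂ F] [TopologicalSpace F]

theorem dual_apply_empty (μ : SpectralMeasure S F) (x : F) (φ : F →L[ℂ] ℂ) : φ (μ ∅ x) = 0 := by
  -- A constant family over `ℕ` is summable only if the constant is zero.
  have h := μ.countably_additive (fun _ => ∅) (fun _ => .empty) (fun _ _ _ => disjoint_bot_left) x φ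
  exact (summable_const_iff _).1 h.summable

open Classical in
/-- The complex measure `A ↦ φ(μ(A)x)`. -/
noncomputable def scalarMeasure (μ : SpectralMeasure S F) (x : F) (φ : F →L[ℂ] ℂ) :
    VectorMeasure S ℂ where
  measureOf' A := if MeasurableSet A then φ (μ A x) else 0
  empty' := by simp [μ.dual_apply_empty]
  not_measurable' A hA := by simp [hA]
  m_iUnion' A hA hd := by
    simpa [hA, MeasurableSet.iUnion hA] using μ.countably_additive A hA hd x φ

theorem scalarMeasure_apply (μ : SpectralMeasure S F) (x : F) (φ : F →L[ℂ] ℂ) {A : Set S}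
    (hA : MeasurableSet A) : μ.scalarMeasure x φ A = φ (μ A x) :=
  if_pos hA

variable [IsTopologicalAddGroup F] [ContinuousSMul ℂ F]

theorem simpleIntegral_eq_sum (μ : SpectralMeasure S F) (g : SimpleFunc S ℂ) :
    μ.simpleIntegral g = ∑ c ∈ g.range, c • μ (g ⁻¹' {c}) := rfl

variable [PolynormableSpace ℂ F] [T2Space F]

theorem apply_empty (μ : SpectralMeasure S F) : μ ∅ = 0 := by
  ext x
  exact eq_of_forall_dual_eq fun φ => by simp [μ.dual_apply_empty]

theorem apply_union (μ : SpectralMeasure S F) {A B : Set S} (hA : MeasurableSet A)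
    (hB : MeasurableSet B) (h : Disjoint A B) : μ (A ∪ B) = μ A + μ B := by
  ext x
  refine eq_of_forall_dual_eq fun φ => ?_
  have := (μ.scalarMeasure x φ).of_union h hA hB
  rw [scalarMeasure_apply _ _ _ (hA.union hB), scalarMeasure_apply _ _ _ hA,
    scalarMeasure_apply _ _ _ hB] at this
  simpa using this

theorem apply_biUnion_finset (μ : SpectralMeasure S F) {ι : Type*} {s : Finset ι} {A : ι → Set S}
    (hd : (s : Set ι).PairwiseDisjoint A) (hA : ∀ i ∈ s, MeasurableSet (A i)) :
    μ (⋃ i ∈ s, A i) = ∑ i ∈ s, μ (A i) := by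
  ext x
  refine eq_of_forall_dual_eq fun φ => ?_
  have := (μ.scalarMeasure x φ).of_biUnion_finset hd hA
  rw [scalarMeasure_apply _ _ _ (s.measurableSet_biUnion hA),
    Finset.sum_congr rfl fun i hi => scalarMeasure_apply _ _ _ (hA i hi)] at this
  simpa using this

theorem apply_compl (μ : SpectralMeasure S F) {A : Set S} (hA : MeasurableSet A) :
    μ Aᶜ = ContinuousLinearMap.id ℂ F - μ A := by
  rw [← μ.map_univ, ← Set.union_compl_self A, μ.apply_union hA hA.compl disjoint_compl_right]
  abel

/-- Integrals of functions of a simple function `k` as sums over any finite set that contains the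
values of `k`. -/
theorem simpleIntegral_map (μ : SpectralMeasure S F) {β : Type*} (k : SimpleFunc S β) (g : β → ℂ)
    (s : Finset β) (hs : k.range ⊆ s) :
    μ.simpleIntegral (k.map g) = ∑ b ∈ s, g b • μ (k ⁻¹' {b}) := by
  classical
  have hd (T : Set β) : T.PairwiseDisjoint fun b => k ⁻¹' {b} := fun a _ b _ hab =>
    (Set.disjoint_singleton.2 hab).preimage k
  have h0 : ∑ b ∈ s, g b • μ (k ⁻¹' {b}) = ∑ b ∈ k.range, g b • μ (k ⁻¹' {b}) := by
    refine (Finset.sum_subset hs fun b _ hb => ?_).symm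
    have : k ⁻¹' {b} = ∅ := by
      ext x
      simp only [Set.mem_preimage, Set.mem_singleton_iff, Set.mem_empty_iff_false, iff_false]
      rintro rfl
      exact hb (k.mem_range_self x)
    rw [this, μ.apply_empty, smul_zero]
  rw [h0, simpleIntegral, SimpleFunc.range_map,
    ← Finset.sum_fiberwise_of_maps_to (fun b hb => Finset.mem_image_of_mem g hb)
      (fun b => g b • μ (k ⁻¹' {b}))]
  refine Finset.sum_congr rfl fun c _ => ?_
  have e : k.map g ⁻¹' {c} = ⋃ b ∈ k.range.filter (fun b => g b = c), k ⁻¹' {b} := by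
    ext x
    simp
  rw [e, μ.apply_biUnion_finset (hd _) (fun b _ => k.measurableSet_fiber b), Finset.smul_sum]
  refine Finset.sum_congr rfl fun b hb => ?_
  rw [(Finset.mem_filter.1 hb).2]

/-- On the joint fibres of `(g, h)` this is exactly `μ(A ∩ B) = μ(A) μ(B)`. -/
theorem simpleIntegral_mul (μ : SpectralMeasure S F) (g h : SimpleFunc S ℂ) :
    μ.simpleIntegral (g * h) = (μ.simpleIntegral g).comp (μ.simpleIntegral h) := by
  have hs : (g.pair h).range ⊆ g.range ×ˢ h.range := by
    intro b hb
    obtain ⟨x, rfl⟩ := SimpleFunc.mem_range.1 hb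
    simp
  have e : g * h = (g.pair h).map fun z => z.1 * z.2 := by ext; simp
  rw [e, μ.simpleIntegral_map _ _ _ hs, Finset.sum_product]
  ext x
  simp only [sum_apply, ContinuousLinearMap.comp_apply,
    smul_apply, simpleIntegral_eq_sum, map_sum, map_smul, Finset.smul_sum]
  rw [Finset.sum_comm]
  refine Finset.sum_congr rfl fun b _ => ?_
  refine Finset.sum_congr rfl fun a _ => ?_
  have e2 : (g.pair h) ⁻¹' {(a, b)} = g ⁻¹' {a} ∩ h ⁻¹' {b} := by
    ext x; simp [Prod.ext_iff]
  rw [e2, μ.map_inter _ _ (g.measurableSet_fiber a) (h.measurableSet_fiber b), smul_smul, mul_comm]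
  rfl

theorem simpleIntegral_sub (μ : SpectralMeasure S F) (g h : SimpleFunc S ℂ) :
    μ.simpleIntegral (g - h) = μ.simpleIntegral g - μ.simpleIntegral h := by
  have e : g - h = (g.pair h).map fun z => z.1 - z.2 := by ext; simp
  have e1 : g = (g.pair h).map fun z => z.1 := by ext; simp
  have e2 : h = (g.pair h).map fun z => z.2 := by ext; simp
  have h1 := μ.simpleIntegral_map (g.pair h) (fun z => z.1) _ subset_rfl
  have h2 := μ.simpleIntegral_map (g.pair h) (fun z => z.2) _ subset_rfl
  rw [← e1] at h1
  rw [← e2] at h2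
  rw [h1, h2, e, μ.simpleIntegral_map _ _ _ subset_rfl, ← Finset.sum_sub_distrib]
  simp only [sub_smul]

theorem simpleIntegral_add (μ : SpectralMeasure S F) (g h : SimpleFunc S ℂ) :
    μ.simpleIntegral (g + h) = μ.simpleIntegral g + μ.simpleIntegral h := by
  have e : g + h = (g.pair h).map fun z => z.1 + z.2 := by ext; simp
  have e1 : g = (g.pair h).map fun z => z.1 := by ext; simp
  have e2 : h = (g.pair h).map fun z => z.2 := by ext; simp
  have h1 := μ.simpleIntegral_map (g.pair h) (fun z => z.1) _ subset_rfl
  have h2 := μ.simpleIntegral_map (g.pair h) (fun z => z.2) _ subset_rfl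
  rw [← e1] at h1
  rw [← e2] at h2
  rw [h1, h2, e, μ.simpleIntegral_map _ _ _ subset_rfl, ← Finset.sum_add_distrib]
  simp only [add_smul]

theorem simpleIntegral_piecewise_const (μ : SpectralMeasure S F) {A : Set S} (hA : MeasurableSet A)
    (c : ℂ) :
    μ.simpleIntegral (.piecewise A hA (.const S c) (.const S 0)) = c • μ A := by
  classical
  -- Factoring through `Bool` keeps the two pieces apart even when `c = 0`.
  let k : SimpleFunc S Bool := .piecewise A hA (.const S true) (.const S false)
  have e : SimpleFunc.piecewise A hA (.const S c) (.const S 0) =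
      k.map fun b => if b then c else 0 := by
    ext x
    by_cases hx : x ∈ A <;> simp [k, hx]
  have e2 : k ⁻¹' {true} = A := by
    ext x
    by_cases hx : x ∈ A <;> simp [k, hx]
  rw [e, μ.simpleIntegral_map k _ Finset.univ (Finset.subset_univ _)]
  simp [e2]

/-- Subset sums of the vectors `μ(g = c) x` are again values `μ(A) x`, so the convexity bound
applies independently of the number of values of `g`. -/
theorem seminorm_simpleIntegral_le (μ : SpectralMeasure S F) (p : Seminorm ℂ F) (x : F) {M K : ℝ}
    (hM : ∀ A, MeasurableSet A → p (μ A x) ≤ M) (hK : 0 < K) (g : SimpleFunc S ℂ)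
    (hg : ∀ s, ‖g s‖ ≤ K) : p (μ.simpleIntegral g x) ≤ 4 * K * M := by
  have hx : μ.simpleIntegral g x = ∑ c ∈ g.range, c • μ (g ⁻¹' {c}) x := by
    simp [simpleIntegral_eq_sum]
  rw [hx]
  refine p.sum_complex_smul_le _ _ hK _ (fun c hc => ?_) fun I _ => ?_
  · obtain ⟨s, rfl⟩ := SimpleFunc.mem_range.1 hc
    exact hg s
  · have := μ.apply_biUnion_finset (s := I) (A := fun c => g ⁻¹' {c})
      (fun a _ b _ hab => (Set.disjoint_singleton.2 hab).preimage g)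
      (fun c _ => g.measurableSet_fiber c)
    have hI : ∑ i ∈ I, μ (g ⁻¹' {i}) x = μ (⋃ c ∈ I, g ⁻¹' {c}) x := by
      rw [this, sum_apply]
    rw [hI]
    exact hM _ (I.measurableSet_biUnion fun c _ => g.measurableSet_fiber c)

end SpectralMeasure

/-! ### Uniform approximation of bounded measurable functions. -/

theorem exists_simpleFunc_dist_lt {S : Type*} [MeasurableSpace S] {h : S → ℂ} (hm : Measurable h)
    {K : ℝ} (hK : ∀ s, ‖h s‖ ≤ K) {ε : ℝ} (hε : 0 < ε) :
    ∃ g : MeasureTheory.SimpleFunc S ℂ, ∀ s, dist (h s) (g s) < ε := by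
  -- By compactness the first `N + 1` points of a dense sequence form an `ε`-net for the range of
  -- `h`; rounding to the nearest one is simple.
  obtain ⟨N, hN⟩ : ∃ N, Metric.closedBall (0 : ℂ) K ⊆
      ⋃ k ≤ N, Metric.ball (TopologicalSpace.denseSeq ℂ k) ε := by
    obtain ⟨N, hN⟩ := (isCompact_closedBall (0 : ℂ) K).elim_directed_cover
      (fun N : ℕ => ⋃ k ≤ N, Metric.ball (TopologicalSpace.denseSeq ℂ k) ε)
      (fun N => isOpen_biUnion fun _ _ => Metric.isOpen_ball) (fun z _ => by
        obtain ⟨k, hk⟩ := (TopologicalSpace.denseRange_denseSeq ℂ).exists_dist_lt z hε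
        exact Set.mem_iUnion.2 ⟨k, Set.mem_biUnion (Set.mem_Iic.2 le_rfl) hk⟩)
      (directed_of_isDirected_le fun a b hab =>
        Set.biUnion_subset_biUnion_left fun k (hk : k ≤ a) => hk.trans hab)
    exact ⟨N, hN⟩
  refine ⟨(MeasureTheory.SimpleFunc.nearestPt (TopologicalSpace.denseSeq ℂ) N).comp h hm,
    fun s => ?_⟩
  have hs := hN (mem_closedBall_zero_iff.2 (hK s))
  simp only [Set.mem_iUnion, Metric.mem_ball] at hs
  obtain ⟨k, hk, hd⟩ := hs
  have := MeasureTheory.SimpleFunc.edist_nearestPt_le (TopologicalSpace.denseSeq ℂ) (h s) hk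
  rw [edist_dist, edist_dist, ENNReal.ofReal_le_ofReal_iff dist_nonneg] at this
  rw [dist_comm] at hd
  exact (dist_comm _ _).trans_lt (this.trans_lt hd)

theorem exists_simpleFunc_tendstoUniformly {S : Type*} [MeasurableSpace S] {h : S → ℂ}
    (hm : Measurable h) {K : ℝ} (hK : ∀ s, ‖h s‖ ≤ K) :
    ∃ g : ℕ → MeasureTheory.SimpleFunc S ℂ,
      TendstoUniformly (fun n s => g n s) h atTop ∧ ∀ n s, ‖g n s‖ ≤ K + 1 := by
  choose g hg using fun n : ℕ => exists_simpleFunc_dist_lt hm hK (Nat.one_div_pos_of_nat (n := n))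
  refine ⟨g, Metric.tendstoUniformly_iff.2 fun ε hε => ?_, fun n s => ?_⟩
  · filter_upwards [tendsto_one_div_add_atTop_nhds_zero_nat.eventually (gt_mem_nhds hε)] with n hn s
    exact (hg n s).trans hn
  · have h1 := hg n s
    have h2 := norm_add_le (g n s - h s) (h s)
    have h3 : (1 : ℝ) / (n + 1) ≤ 1 := div_le_one_of_le₀ (by simp) (by positivity)
    rw [dist_comm, dist_eq_norm] at h1
    rw [sub_add_cancel] at h2
    linarith [hK s]

/-! ### Functional calculus for bounded functions and bounded convergence. -/

namespace SpectralMeasure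

open MeasureTheory

variable {S F : Type*} [MeasurableSpace S] [AddCommGroup F] [Module ℂ F] [TopologicalSpace F]
  [IsTopologicalAddGroup F] [ContinuousSMul ℂ F] {μ : SpectralMeasure S F} {h k : S → ℂ}
  {T T' : F →L[ℂ] F}

theorem hasIntegral_simple (μ : SpectralMeasure S F) (g : SimpleFunc S ℂ) :
    μ.HasIntegral g (μ.simpleIntegral g) :=
  ⟨fun _ => g, Metric.tendstoUniformly_iff.2 fun ε hε => by simp [hε], fun _ => tendsto_const_nhds⟩

theorem HasIntegral.exists_bound (hT : μ.HasIntegral h T) : ∃ K : ℝ, 0 < K ∧ ∀ s, ‖h s‖ ≤ K := by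
  obtain ⟨g, hg, -⟩ := hT
  obtain ⟨n, hn⟩ := (Metric.tendstoUniformly_iff.1 hg 1 one_pos).exists
  obtain ⟨C, hC⟩ := (g n).exists_forall_norm_le
  refine ⟨|C| + 1, by positivity, fun s => ?_⟩
  have h1 := hn s
  rw [dist_eq_norm] at h1
  have h2 := norm_add_le (h s - g n s) (g n s)
  rw [sub_add_cancel] at h2
  linarith [hC s, le_abs_self C]

variable [PolynormableSpace ℂ F] [T2Space F]

theorem hasIntegral_indicator_const (μ : SpectralMeasure S F) {A : Set S} (hA : MeasurableSet A)
    (c : ℂ) : μ.HasIntegral (A.indicator fun _ => c) (c • μ A) := by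
  classical
  have := μ.hasIntegral_simple (.piecewise A hA (.const S c) (.const S 0))
  rw [simpleIntegral_piecewise_const] at this
  convert this using 1
  ext s
  by_cases hs : s ∈ A <;> simp [hs]

theorem hasIntegral_indicator_one (μ : SpectralMeasure S F) {A : Set S} (hA : MeasurableSet A) :
    μ.HasIntegral (A.indicator fun _ => 1) (μ A) := by
  simpa using μ.hasIntegral_indicator_const hA 1

theorem hasIntegral_const (μ : SpectralMeasure S F) (c : ℂ) :
    μ.HasIntegral (fun _ => c) (c • ContinuousLinearMap.id ℂ F) := by
  simpa [μ.map_univ] using μ.hasIntegral_indicator_const MeasurableSet.univ c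

theorem HasIntegral.add (hT : μ.HasIntegral h T) (hT' : μ.HasIntegral k T') :
    μ.HasIntegral (fun s => h s + k s) (T + T') := by
  obtain ⟨g, hg, hgT⟩ := hT
  obtain ⟨g', hg', hgT'⟩ := hT'
  refine ⟨fun n => g n + g' n, hg.add hg', fun x => ?_⟩
  simp only [simpleIntegral_add]
  exact (hgT x).add (hgT' x)

theorem HasIntegral.sub (hT : μ.HasIntegral h T) (hT' : μ.HasIntegral k T') :
    μ.HasIntegral (fun s => h s - k s) (T - T') := by
  obtain ⟨g, hg, hgT⟩ := hT
  obtain ⟨g', hg', hgT'⟩ := hT'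
  refine ⟨fun n => g n - g' n, hg.sub hg', fun x => ?_⟩
  simp only [simpleIntegral_sub]
  exact (hgT x).sub (hgT' x)

theorem HasIntegral.seminorm_apply_le (hT : μ.HasIntegral h T) (p : Seminorm ℂ F)
    (hp : Continuous p) {K M : ℝ} (hK : 0 ≤ K) (hh : ∀ s, ‖h s‖ ≤ K) {x : F}
    (hM : ∀ A, MeasurableSet A → p (μ A x) ≤ M) : p (T x) ≤ 4 * K * M := by
  obtain ⟨g, hg, hgT⟩ := hT
  have key (ε : ℝ) (hε : 0 < ε) : p (T x) ≤ 4 * (K + ε) * M := by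
    refine le_of_tendsto ((hp.tendsto _).comp (hgT x)) ?_
    filter_upwards [Metric.tendstoUniformly_iff.1 hg ε hε] with n hn
    refine μ.seminorm_simpleIntegral_le p x hM (by linarith) _ fun s => ?_
    have h1 := hn s
    rw [dist_comm, dist_eq_norm] at h1
    have h2 := norm_add_le (g n s - h s) (h s)
    rw [sub_add_cancel] at h2
    linarith [hh s]
  have hlim : Tendsto (fun ε : ℝ => 4 * (K + ε) * M) (𝓝[>] 0) (𝓝 (4 * (K + 0) * M)) :=
    tendsto_nhdsWithin_of_tendsto_nhds (by fun_prop : Continuous fun ε : ℝ =>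
      4 * (K + ε) * M).continuousAt
  rw [add_zero] at hlim
  exact ge_of_tendsto hlim (eventually_mem_nhdsWithin.mono fun ε hε => key ε hε)

theorem HasIntegral.mul (hμ : μ.IsEquicontinuous) (hT : μ.HasIntegral h T)
    (hT' : μ.HasIntegral k T') : μ.HasIntegral (fun s => h s * k s) (T.comp T') := by
  obtain ⟨K, hK, hh⟩ := hT.exists_bound
  obtain ⟨K', hK', hk⟩ := hT'.exists_bound
  obtain ⟨g, hg, hgT⟩ := hT
  obtain ⟨g', hg', hgT'⟩ := hT'
  have hg1 : ∀ᶠ n in atTop, ∀ s, ‖g n s‖ ≤ K + 1 := by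
    filter_upwards [Metric.tendstoUniformly_iff.1 hg 1 one_pos] with n hn s
    have h1 := hn s
    rw [dist_comm, dist_eq_norm] at h1
    have h2 := norm_add_le (g n s - h s) (h s)
    rw [sub_add_cancel] at h2
    linarith [hh s]
  refine ⟨fun n => g n * g' n, Metric.tendstoUniformly_iff.2 fun ε hε => ?_, fun x => ?_⟩
  -- Chosen so that `δ * K' + (K + 1) * δ = ε / 2`.
  · set δ : ℝ := ε / (2 * (K + 1 + K'))
    have hδ : 0 < δ := by positivity
    filter_upwards [Metric.tendstoUniformly_iff.1 hg δ hδ,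
      Metric.tendstoUniformly_iff.1 hg' δ hδ, hg1] with n h1 h2 h3 s
    have e : h s * k s - g n s * g' n s = (h s - g n s) * k s + g n s * (k s - g' n s) := by ring
    have h1' := h1 s
    have h2' := h2 s
    rw [dist_eq_norm] at h1' h2'
    rw [dist_eq_norm, SimpleFunc.mul_apply, e]
    calc _ ≤ ‖h s - g n s‖ * ‖k s‖ + ‖g n s‖ * ‖k s - g' n s‖ := by
          simpa only [norm_mul] using norm_add_le ((h s - g n s) * k s) (g n s * (k s - g' n s))
      _ ≤ δ * K' + (K + 1) * δ := by
          gcongr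
          exacts [hk s, h3 s]
      _ = ε / 2 := by simp only [δ]; field_simp; ring
      _ < ε := half_lt_self hε
  · simp only [simpleIntegral_mul, ContinuousLinearMap.comp_apply]
    have h1 : Tendsto (fun n => μ.simpleIntegral (g n) (μ.simpleIntegral (g' n) x - T' x)) atTop
        (𝓝 0) := by
      rw [tendsto_iff_forall_continuous_seminorm]
      intro p hp
      obtain ⟨q, hq, hpq⟩ := hμ p hp
      have h2 : Tendsto (fun n => 4 * (K + 1) * q (μ.simpleIntegral (g' n) x - T' x)) atTop
          (𝓝 0) := by
        simpa using
          (tendsto_iff_forall_continuous_seminorm.1 (hgT' x) q hq).const_mul (4 * (K + 1))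
      refine squeeze_zero' (Eventually.of_forall fun n => apply_nonneg p _) ?_ h2
      filter_upwards [hg1] with n hn
      rw [sub_zero]
      exact μ.seminorm_simpleIntegral_le p _ (fun A hA => hpq A hA _) (by linarith) _ hn
    simpa using h1.add (hgT (T' x))

theorem HasIntegral.const_mul (hμ : μ.IsEquicontinuous) (hT : μ.HasIntegral h T) (c : ℂ) :
    μ.HasIntegral (fun s => c * h s) (c • T) := by
  simpa using (μ.hasIntegral_const c).mul hμ hT

theorem HasIntegral.pow (hμ : μ.IsEquicontinuous) (hT : μ.HasIntegral h T) (n : ℕ) :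
    μ.HasIntegral (fun s => h s ^ n) (T ^ n) := by
  induction n with
  | zero => simpa using! μ.hasIntegral_const 1
  | succ n ih => simpa only [pow_succ] using! ih.mul hμ hT

theorem hasIntegral_sum {ι : Type*} (s : Finset ι) {h : ι → S → ℂ} {T : ι → F →L[ℂ] F}
    (hT : ∀ i ∈ s, μ.HasIntegral (h i) (T i)) :
    μ.HasIntegral (fun x => ∑ i ∈ s, h i x) (∑ i ∈ s, T i) := by
  classical
  induction s using Finset.induction_on with
  | empty => simpa using μ.hasIntegral_const 0
  | insert j s hj ih =>
    simpa only [Finset.sum_insert hj] using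
      (hT j (Finset.mem_insert_self _ _)).add (ih fun i hi => hT i (Finset.mem_insert_of_mem hi))

/-- Weak countable additivity of an equicontinuous spectral measure implies strong continuity
from above. -/
theorem tendsto_apply_of_antitone (hμ : μ.IsEquicontinuous) {A : ℕ → Set S} (hA : Antitone A)
    (hm : ∀ n, MeasurableSet (A n)) (h0 : ⋂ n, A n = ∅) (x : F) :
    Tendsto (fun n => μ (A n) x) atTop (𝓝 0) := by
  -- The vectors of strong convergence form a subspace, closed by equicontinuity and hence weakly
  -- closed.
  let M : Submodule ℂ F :=
    { carrier := {x | Tendsto (fun n => μ (A n) x) atTop (𝓝 0)}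
      add_mem' := fun {a b} ha hb => by
        have := Tendsto.add (show Tendsto (fun n => μ (A n) a) atTop (𝓝 0) from ha)
          (show Tendsto (fun n => μ (A n) b) atTop (𝓝 0) from hb)
        simpa using this
      zero_mem' := by simp
      smul_mem' := fun c a ha => by
        have := Tendsto.const_smul (show Tendsto (fun n => μ (A n) a) atTop (𝓝 0) from ha) c
        simpa using this }
  have hM : IsClosed (M : Set F) := by
    refine isClosed_of_closure_subset fun y hy => ?_
    change Tendsto (fun n => μ (A n) y) atTop (𝓝 0)
    rw [tendsto_iff_forall_continuous_seminorm]
    intro p hp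
    obtain ⟨q, hq, hpq⟩ := hμ p hp
    rw [Metric.tendsto_nhds]
    intro ε hε
    have hnhds : {z | q (y - z) < ε / 2} ∈ 𝓝 y := by
      refine IsOpen.mem_nhds ?_ (by simpa using half_pos hε)
      exact isOpen_lt (hq.comp (continuous_const.sub continuous_id)) continuous_const
    obtain ⟨z, hz, hzM⟩ := mem_closure_iff_nhds.1 hy _ hnhds
    have hz' := tendsto_iff_forall_continuous_seminorm.1
      (show Tendsto (fun n => μ (A n) z) atTop (𝓝 0) from hzM) p hp
    filter_upwards [hz'.eventually (gt_mem_nhds (half_pos hε))] with n hn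
    rw [sub_zero] at hn
    rw [dist_zero_right, Real.norm_of_nonneg (apply_nonneg p _), sub_zero]
    have e : μ (A n) y = μ (A n) (y - z) + μ (A n) z := by simp
    rw [e]
    have h1 := hpq _ (hm n) (y - z)
    have h2 := map_add_le_add p (μ (A n) (y - z)) (μ (A n) z)
    have h3 : q (y - z) < ε / 2 := hz
    linarith
  -- For `m ≥ n` the operator `μ(A m)` kills `x - μ(A n) x`, so these vectors lie in `M`; they
  -- converge weakly to `x` by weak countable additivity.
  refine (mem_closed_submodule_of_weak_limit hM (u := fun n => x - μ (A n) x) (fun n => ?_)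
    fun φ => ?_ : x ∈ M)
  · refine (tendsto_congr' ?_).2 (tendsto_const_nhds (x := (0 : F)))
    filter_upwards [eventually_ge_atTop n] with m hmn
    have := congrArg (fun T => T x) (μ.map_inter (A m) (A n) (hm m) (hm n))
    rw [Set.inter_eq_left.2 (hA hmn)] at this
    simpa [sub_eq_zero] using this
  · have := (μ.scalarMeasure x φ).tendsto_vectorMeasure_iInter_atTop_nat hA hm
    rw [h0, VectorMeasure.empty] at this
    simp only [μ.scalarMeasure_apply x φ (hm _)] at this
    simpa using this.const_sub (φ x)

/-- Bounded convergence for equicontinuous spectral measures. -/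
theorem tendsto_zero_of_hasIntegral (hμ : μ.IsEquicontinuous) {d : ℕ → S → ℂ}
    {T : ℕ → F →L[ℂ] F} (hT : ∀ n, μ.HasIntegral (d n) (T n)) (hm : ∀ n, Measurable (d n)) {K : ℝ}
    (hK : ∀ n s, ‖d n s‖ ≤ K) (hd : ∀ s, Tendsto (fun n => d n s) atTop (𝓝 0)) (x : F) :
    Tendsto (fun n => T n x) atTop (𝓝 0) := by
  rw [tendsto_iff_forall_continuous_seminorm]
  intro p hp
  obtain ⟨q, hq, hpq⟩ := hμ p hp
  rw [Metric.tendsto_nhds]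
  intro ε hε
  set δ : ℝ := ε / (8 * (q x + 1))
  have hqx : 0 ≤ q x := apply_nonneg q x
  have hδ : 0 < δ := by positivity
  -- As in Egorov's theorem: off `A n` the integrand `d n` is below `δ`, while `μ(A n) x` tends to
  -- zero because pointwise convergence empties the intersection.
  let A : ℕ → Set S := fun N => ⋃ n, ⋃ (_ : N ≤ n), {s | δ ≤ ‖d n s‖}
  have hA : ∀ N, MeasurableSet (A N) := fun N => MeasurableSet.iUnion fun n =>
    MeasurableSet.iUnion fun _ => measurableSet_le measurable_const (hm n).norm
  have hanti : Antitone A := fun a b hab =>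
    Set.biUnion_subset_biUnion_left fun n (hn : b ≤ n) => hab.trans hn
  have h0 : ⋂ N, A N = ∅ := by
    refine Set.eq_empty_of_forall_notMem fun s hs => ?_
    have h1 := (hd s).norm
    rw [norm_zero] at h1
    obtain ⟨N, hN⟩ := eventually_atTop.1 (h1.eventually (gt_mem_nhds hδ))
    have h2 := Set.mem_iInter.1 hs N
    simp only [A, Set.mem_iUnion, Set.mem_ofPred_eq] at h2
    obtain ⟨n, hn, hle⟩ := h2
    exact absurd (hN n hn) (not_lt.2 hle)
  have hKp : 0 ≤ |K| := abs_nonneg K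
  have h2 := (tendsto_iff_forall_continuous_seminorm.1
    (tendsto_apply_of_antitone hμ hanti hA h0 x) q hq).const_mul (4 * |K|)
  rw [mul_zero] at h2
  filter_upwards [h2.eventually (gt_mem_nhds (half_pos hε))] with n hn
  rw [sub_zero] at hn
  rw [dist_zero_right, Real.norm_of_nonneg (apply_nonneg p _), sub_zero]
  have e : T n x = (T n).comp (μ (A n)ᶜ) x + T n (μ (A n) x) := by
    rw [μ.apply_compl (hA n)]
    simp
  have h3 : p (T n (μ (A n) x)) ≤ 4 * |K| * q (μ (A n) x) :=
    (hT n).seminorm_apply_le p hp hKp (fun s => (hK n s).trans (le_abs_self K))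
      fun B hB => hpq B hB _
  have h4 : p ((T n).comp (μ (A n)ᶜ) x) ≤ 4 * δ * q x := by
    refine ((hT n).mul hμ (μ.hasIntegral_indicator_one (hA n).compl)).seminorm_apply_le p hp hδ.le
      (fun s => ?_) fun B hB => hpq B hB _
    by_cases hs : s ∈ A n
    · simp [hs, hδ.le]
    · have : ¬ δ ≤ ‖d n s‖ := fun h => hs (Set.mem_biUnion (Set.mem_Ici.2 le_rfl) h)
      simpa [hs] using (not_le.1 this).le
  have h5 : 4 * δ * q x ≤ ε / 2 := by
    have : 4 * δ * (q x + 1) = ε / 2 := by simp only [δ]; field_simp; ring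
    nlinarith
  rw [e]
  have h6 := map_add_le_add p ((T n).comp (μ (A n)ᶜ) x) (T n (μ (A n) x))
  linarith

end SpectralMeasure

/-! ### Vanishing of the spectral measure on the resolvent set. -/

open MeasureTheory in
/-- A finite measure on the plane vanishes on every set at whose points the measure of balls of
radius `r` is `O(r ^ 3)`. -/
theorem measure_eq_zero_of_closedBall_le_cube (m : Measure ℂ) [IsFiniteMeasure m] {B : Set ℂ}
    (hB : ∀ ξ ∈ B, ∃ C : ℝ, ∀ r : ℝ, 0 < r → m (Metric.closedBall ξ r) ≤ ENNReal.ofReal (C * r ^ 3)) :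
    m B = 0 := by
  suffices h : ∀ᵐ ξ ∂m, ξ ∉ B by simpa [ae_iff] using h
  -- The density is that of area with respect to `m`: it is finite `m`-almost everywhere, but at
  -- points of `B` the ratio `π r² / (D r³)` blows up.
  filter_upwards [Besicovitch.ae_tendsto_rnDeriv volume m, Measure.rnDeriv_lt_top volume m]
    with ξ hξ hfin hξB
  obtain ⟨C, hC⟩ := hB ξ hξB
  set D : ℝ := max C 1
  have hD : 0 < D := lt_of_lt_of_le one_pos (le_max_right _ _)
  have h1 : Tendsto (fun r : ℝ => ENNReal.ofReal (Real.pi / D * r⁻¹)) (𝓝[>] 0) (𝓝 ⊤) :=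
    ENNReal.tendsto_ofReal_atTop.comp
      (tendsto_inv_nhdsGT_zero.const_mul_atTop (div_pos Real.pi_pos hD))
  refine hfin.not_ge (le_of_tendsto_of_tendsto h1 hξ ?_)
  filter_upwards [self_mem_nhdsWithin] with r hr
  have hr : 0 < r := hr
  have h2 : m (Metric.closedBall ξ r) ≤ ENNReal.ofReal (D * r ^ 3) :=
    (hC r hr).trans (ENNReal.ofReal_le_ofReal (by gcongr; exact le_max_left _ _))
  have h3 : volume (Metric.closedBall ξ r) = ENNReal.ofReal (Real.pi * r ^ 2) := by
    rw [Complex.volume_closedBall, mul_comm, ENNReal.ofReal_mul Real.pi_pos.le,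
      ENNReal.ofReal_pow hr.le, ← NNReal.coe_real_pi, ENNReal.ofReal_coe_nnreal]
  rw [h3]
  calc ENNReal.ofReal (Real.pi / D * r⁻¹)
      = ENNReal.ofReal (Real.pi * r ^ 2) / ENNReal.ofReal (D * r ^ 3) := by
        rw [← ENNReal.ofReal_div_of_pos (by positivity)]
        congr 1
        field_simp
    _ ≤ _ := ENNReal.div_le_div_left h2 _

open MeasureTheory in
-- A Hahn decomposition splits `B` into two subsets carrying the positive and the negative
-- variation, each of mass at most `M`.
theorem totalVariation_le_of_forall_subset_abs_le (ν : SignedMeasure ℂ) {B : Set ℂ}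
    (hB : MeasurableSet B) {M : ℝ} (hM : ∀ A ⊆ B, MeasurableSet A → |ν A| ≤ M) :
    ν.totalVariation B ≤ ENNReal.ofReal (2 * M) := by
  obtain ⟨i, hi, h0, h1, hp, hn⟩ := ν.toJordanDecomposition_spec
  have hM0 : 0 ≤ M := (abs_nonneg _).trans (hM _ subset_rfl hB)
  have e1 := SignedMeasure.toMeasureOfZeroLE_real_apply ν h0 hi hB
  have e2 := SignedMeasure.toMeasureOfLEZero_real_apply ν h1 hi.compl hB
  rw [← hp] at e1
  rw [← hn] at e2
  have b1 := hM _ Set.inter_subset_right (hi.inter hB)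
  have b2 := hM _ Set.inter_subset_right (hi.compl.inter hB)
  rw [SignedMeasure.totalVariation, Measure.add_apply, two_mul, ENNReal.ofReal_add hM0 hM0]
  refine add_le_add ?_ ?_
  · rw [← ofReal_measureReal, e1]
    exact ENNReal.ofReal_le_ofReal ((le_abs_self _).trans b1)
  · rw [← ofReal_measureReal, e2]
    exact ENNReal.ofReal_le_ofReal ((neg_le_abs _).trans b2)

namespace SpectralMeasure

open MeasureTheory

variable {S F : Type*} [MeasurableSpace S] [AddCommGroup F] [Module ℂ F] [TopologicalSpace F]
  [IsTopologicalAddGroup F] [ContinuousSMul ℂ F] [PolynormableSpace ℂ F] [T2Space F]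
  {μ : SpectralMeasure S F} {f : S → ℂ} {U : F →L[ℂ] F}

/-- At a point `ξ` of the resolvent set the spectral measure of the balls of radius `r` around `ξ`
is `O(r ^ 3)`. -/
theorem exists_seminorm_apply_le_cube (hμ : μ.IsEquicontinuous) (hf : Measurable f)
    (hU : μ.HasIntegral f U) {ξ : ℂ} (hξ : ξ ∈ lcResolventSet U) (p : Seminorm ℂ F)
    (hp : Continuous p) (x : F) :
    ∃ C : ℝ, ∀ r : ℝ, 0 < r → ∀ A ⊆ Metric.closedBall ξ r, MeasurableSet A →
      p (μ (f ⁻¹' A) x) ≤ C * r ^ 3 := by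
  set W : F →L[ℂ] F := shiftedOp U ξ
  have hW : μ.HasIntegral (fun s => ξ - f s) W := (μ.hasIntegral_const ξ).sub hU
  -- Three factors `ξ - f` give `r ^ 3`, which beats the area `π r ^ 2`. The cube of `W` is still an
  -- embedding, so the bound transfers back to `μ (f ⁻¹' A) x`.
  have hW3 := hW.mul hμ (hW.mul hμ hW)
  have hind : IsInducing (W.comp (W.comp W)) :=
    (hξ.2.comp (hξ.2.comp hξ.2)).isInducing
  obtain ⟨q, hq, hpq⟩ := Seminorm.exists_le_comp_of_isInducing hp
    (f := (W.comp (W.comp W) : F →ₗ[ℂ] F)) hind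
  obtain ⟨q', -, hq'⟩ := hμ q hq
  refine ⟨4 * q' x, fun r hr A hA hAm => ?_⟩
  have h1 : p (μ (f ⁻¹' A) x) ≤ q ((W.comp (W.comp W)).comp (μ (f ⁻¹' A)) x) := hpq _
  have h2 := (hW3.mul hμ (μ.hasIntegral_indicator_one (hf hAm))).seminorm_apply_le q hq
    (K := r ^ 3) (by positivity) (fun s => ?_) (fun B hB => hq' B hB x)
  · linarith
  · by_cases hs : f s ∈ A
    · have h3 : ‖ξ - f s‖ ≤ r := by
        rw [← dist_eq_norm, dist_comm]
        exact hA hs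
      have hs' : s ∈ f ⁻¹' A := hs
      simp only [Set.indicator_of_mem hs', mul_one, norm_mul]
      calc _ ≤ r * (r * r) := by gcongr
        _ = r ^ 3 := by ring
    · have hs' : s ∉ f ⁻¹' A := hs
      simp only [Set.indicator_of_notMem hs', mul_zero, norm_zero]
      positivity

/-- The spectral measure of `U` vanishes on Borel subsets of the resolvent set. -/
theorem apply_preimage_eq_zero (hμ : μ.IsEquicontinuous) (hf : Measurable f)
    (hU : μ.HasIntegral f U) {B : Set ℂ} (hB : MeasurableSet B) (hBU : B ⊆ lcResolventSet U) :
    μ (f ⁻¹' B) = 0 := by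
  ext x
  refine eq_of_forall_re_dual_eq fun φ => ?_
  let ν : SignedMeasure ℂ := ComplexMeasure.re ((μ.map f hf).scalarMeasure x φ)
  have hν {A : Set ℂ} (hA : MeasurableSet A) : ν A = (φ (μ (f ⁻¹' A) x)).re :=
    congrArg Complex.re ((μ.map f hf).scalarMeasure_apply x φ hA)
  have h0 : ν.totalVariation B = 0 := by
    refine measure_eq_zero_of_closedBall_le_cube _ fun ξ hξ => ?_
    obtain ⟨C, hC⟩ := exists_seminorm_apply_le_cube hμ hf hU (hBU hξ)
      ((normSeminorm ℂ ℂ).comp (φ : F →ₗ[ℂ] ℂ)) (continuous_norm.comp φ.continuous) x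
    refine ⟨2 * C, fun r hr => ?_⟩
    rw [mul_assoc]
    refine totalVariation_le_of_forall_subset_abs_le ν Metric.isClosed_closedBall.measurableSet
      fun A hA hAm => ?_
    rw [hν hAm]
    exact (Complex.abs_re_le_norm _).trans (hC r hr A hA hAm)
  rw [← hν hB, ν.null_of_totalVariation_zero h0]
  simp

end SpectralMeasure

/-! ### Scalar averages and invertibility criteria. -/

theorem Complex.norm_average_pow_le {w : ℂ} (hw : ‖w‖ ≤ 1) (n : ℕ) :
    ‖(n : ℂ)⁻¹ * ∑ k ∈ Finset.range n, w ^ k‖ ≤ 1 := by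
  rw [norm_mul, norm_inv, Complex.norm_natCast]
  have h : ‖∑ k ∈ Finset.range n, w ^ k‖ ≤ n := by
    refine (norm_sum_le_of_le _ fun k _ => (norm_pow w k).trans_le
      (pow_le_one₀ (norm_nonneg w) hw)).trans ?_
    simp
  calc (n : ℝ)⁻¹ * ‖∑ k ∈ Finset.range n, w ^ k‖ ≤ (n : ℝ)⁻¹ * n := by gcongr
    _ ≤ 1 := inv_mul_le_one

theorem Complex.tendsto_average_pow {w : ℂ} (hw : ‖w‖ ≤ 1) :
    Tendsto (fun n : ℕ => (n : ℂ)⁻¹ * ∑ k ∈ Finset.range n, w ^ k) atTop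
      (𝓝 (if w = 1 then 1 else 0)) := by
  split_ifs with h
  · refine tendsto_const_nhds.congr' ?_
    filter_upwards [eventually_ne_atTop 0] with n hn
    have : (n : ℂ) ≠ 0 := by exact_mod_cast hn
    simp [h, this]
  · have h1 : Tendsto (fun n : ℕ => (n : ℝ)⁻¹ * (2 / ‖w - 1‖)) atTop (𝓝 0) := by
      simpa using tendsto_inv_atTop_nhds_zero_nat.mul_const (2 / ‖w - 1‖)
    refine squeeze_zero_norm (fun n => ?_) h1
    rw [norm_mul, norm_inv, Complex.norm_natCast, geom_sum_eq h, norm_div]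
    gcongr
    refine (norm_sub_le _ _).trans ?_
    rw [norm_one, norm_pow]
    linarith [pow_le_one₀ (n := n) (norm_nonneg w) hw]

theorem ContinuousLinearMap.isInvertible_of_isEmbedding {F : Type*} [AddCommGroup F] [Module ℂ F]
    [TopologicalSpace F] {U : F →L[ℂ] F} (hU : IsEmbedding U) (hs : Function.Surjective U) :
    U.IsInvertible := by
  let e : F ≃ₗ[ℂ] F := LinearEquiv.ofBijective (U : F →ₗ[ℂ] F) ⟨hU.injective, hs⟩
  have he : (U : F → F) ∘ e.symm = id := funext fun x => e.apply_symm_apply x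
  refine ⟨ContinuousLinearEquiv.mk e U.continuous ?_, rfl⟩
  change Continuous e.symm
  rw [hU.isInducing.continuous_iff, he]
  exact continuous_id

theorem norm_indicator_inv_le {S : Type*} (f : S → ℂ) {c : ℝ} (hc : 0 < c) (s : S) :
    ‖{s | c ≤ ‖f s‖}.indicator (fun s => (f s)⁻¹) s‖ ≤ c⁻¹ := by
  by_cases hs : c ≤ ‖f s‖
  · rw [Set.indicator_of_mem (show s ∈ {s | c ≤ ‖f s‖} from hs), norm_inv]
    exact inv_anti₀ hc hs
  · rw [Set.indicator_of_notMem (show s ∉ {s | c ≤ ‖f s‖} from hs), norm_zero]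
    exact (inv_pos.2 hc).le

/-! ### The inverse as an integral and the mean ergodic theorem. -/

namespace SpectralMeasure

open MeasureTheory

variable {S F : Type*} [MeasurableSpace S] [AddCommGroup F] [Module ℂ F] [TopologicalSpace F]
  [IsTopologicalAddGroup F] [ContinuousSMul ℂ F] [PolynormableSpace ℂ F] [T2Space F]
  {μ : SpectralMeasure S F} {f : S → ℂ} {U : F →L[ℂ] F} {c : ℝ}

/-- Simple approximations of `1 / f` yield approximate right inverses of `U`. -/
theorem tendsto_apply_simpleIntegral (hμ : μ.IsEquicontinuous) (hf : Measurable f)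
    (hU : μ.HasIntegral f U) (hc : 0 < c) (hμc : μ {s | c ≤ ‖f s‖} = ContinuousLinearMap.id ℂ F)
    {g : ℕ → SimpleFunc S ℂ}
    (hg : ∀ s, Tendsto (fun n => g n s) atTop
      (𝓝 ({s | c ≤ ‖f s‖}.indicator (fun s => (f s)⁻¹) s)))
    {K : ℝ} (hK : ∀ n s, ‖g n s‖ ≤ K) (x : F) :
    Tendsto (fun n => U (μ.simpleIntegral (g n) x)) atTop (𝓝 x) := by
  have hm : MeasurableSet {s | c ≤ ‖f s‖} := measurableSet_le measurable_const hf.norm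
  obtain ⟨L, hL, hfL⟩ := hU.exists_bound
  have h := tendsto_zero_of_hasIntegral hμ (K := L * K + 1)
    (fun n => (hU.mul hμ (μ.hasIntegral_simple (g n))).sub (μ.hasIntegral_indicator_one hm))
    (fun n => (hf.mul (g n).measurable).sub (measurable_const.indicator hm)) (fun n s => ?_)
    (fun s => ?_) x
  · rw [hμc] at h
    simpa using h.add_const x
  · refine (norm_sub_le _ _).trans (add_le_add ?_ ?_)
    · rw [norm_mul]
      exact mul_le_mul (hfL s) (hK n s) (norm_nonneg _) hL.le
    · by_cases hs : s ∈ {s | c ≤ ‖f s‖} <;> simp only [Set.indicator_of_mem, hs,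
        Set.indicator_of_notMem, not_false_eq_true, norm_one, norm_zero, le_refl, zero_le_one]
  · have h1 := ((hg s).const_mul (f s)).sub_const ({s | c ≤ ‖f s‖}.indicator (fun _ => 1) s)
    convert h1 using 2
    by_cases hs : s ∈ {s | c ≤ ‖f s‖}
    · have h2 : f s ≠ 0 := norm_pos_iff.1 (hc.trans_le hs)
      simp only [Set.indicator_of_mem hs, mul_inv_cancel₀ h2, sub_self]
    · simp only [Set.indicator_of_notMem hs, mul_zero, sub_self]

theorem measurable_indicator_inv (hf : Measurable f) (c : ℝ) :
    Measurable ({s | c ≤ ‖f s‖}.indicator fun s => (f s)⁻¹) :=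
  hf.inv.indicator (measurableSet_le measurable_const hf.norm)

/-- The approximate preimages of `x` are bounded by equicontinuity. A subsequence converges weakly
to some `y`, and `U y = x` because `U` is weakly continuous. -/
theorem surjective_of_hasIntegral (hF : LocallySeqWeaklyCompact F) (hμ : μ.IsEquicontinuous)
    (hf : Measurable f) (hU : μ.HasIntegral f U) (hc : 0 < c)
    (hμc : μ {s | c ≤ ‖f s‖} = ContinuousLinearMap.id ℂ F) : Function.Surjective U := by
  intro x
  obtain ⟨g, hg, hgb⟩ := exists_simpleFunc_tendstoUniformly (measurable_indicator_inv hf c)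
    (norm_indicator_inv_le f hc)
  have hUg := tendsto_apply_simpleIntegral hμ hf hU hc hμc (fun s => hg.tendsto_at s) hgb x
  have hbdd : Bornology.IsVonNBounded ℂ (Set.range fun n => μ.simpleIntegral (g n) x) := by
    rw [(PolynormableSpace.withSeminorms ℂ F).isVonNBounded_iff_seminorm_bounded]
    rintro ⟨p, hp⟩
    obtain ⟨q, -, hpq⟩ := hμ p hp
    refine ⟨4 * (c⁻¹ + 1) * q x + 1, by positivity, ?_⟩
    rintro _ ⟨n, rfl⟩
    have := μ.seminorm_simpleIntegral_le p x (fun A hA => hpq A hA x)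
      (by positivity : 0 < c⁻¹ + 1) (g n) (hgb n)
    exact this.trans_lt (lt_add_one _)
  obtain ⟨y, k, hk, hy⟩ := hF _ hbdd
  refine ⟨y, eq_of_forall_dual_eq fun φ => ?_⟩
  exact tendsto_nhds_unique (hy (φ.comp U))
    (((φ.continuous.tendsto x).comp hUg).comp hk.tendsto_atTop)

/-- Applying the continuous inverse to the approximate right inverses makes them converge strongly
to `U.inverse`. -/
theorem hasIntegral_inverse (hμ : μ.IsEquicontinuous) (hf : Measurable f)
    (hU : μ.HasIntegral f U) (hc : 0 < c) (hμc : μ {s | c ≤ ‖f s‖} = ContinuousLinearMap.id ℂ F)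
    (hinv : U.IsInvertible) :
    μ.HasIntegral ({s | c ≤ ‖f s‖}.indicator fun s => (f s)⁻¹) U.inverse := by
  obtain ⟨g, hg, hgb⟩ := exists_simpleFunc_tendstoUniformly (measurable_indicator_inv hf c)
    (norm_indicator_inv_le f hc)
  refine ⟨g, hg, fun x => ?_⟩
  have hUg := tendsto_apply_simpleIntegral hμ hf hU hc hμc (fun s => hg.tendsto_at s) hgb x
  have h := (U.inverse.continuous.tendsto x).comp hUg
  refine h.congr fun n => ?_
  exact hinv.inverse_apply_eq.2 rfl

/-- The mean ergodic theorem for multiplication-type operators `V = ∫ w dμ` with `|w| ≤ 1`. -/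
theorem tendsto_averageOp (hμ : μ.IsEquicontinuous) {w : S → ℂ} (hwm : Measurable w)
    (hw : ∀ s, ‖w s‖ ≤ 1) {V : F →L[ℂ] F} (hV : μ.HasIntegral w V) (x : F) :
    Tendsto (fun n => averageOp n V x) atTop (𝓝 (μ (w ⁻¹' {1}) x)) := by
  have hm : MeasurableSet (w ⁻¹' {1}) := hwm (measurableSet_singleton 1)
  have h := tendsto_zero_of_hasIntegral hμ (K := 2)
    (fun n : ℕ => ((hasIntegral_sum (Finset.range n) fun k _ => hV.pow hμ k).const_mul hμ
      (n : ℂ)⁻¹).sub (μ.hasIntegral_indicator_one hm))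
    (fun n => (by fun_prop : Measurable fun s => (n : ℂ)⁻¹ * ∑ k ∈ Finset.range n, w s ^ k).sub
      (measurable_const.indicator hm)) (fun n s => ?_) (fun s => ?_) x
  · simpa [averageOp] using h.add_const (μ (w ⁻¹' {1}) x)
  · refine (norm_sub_le _ _).trans ?_
    have h1 := Complex.norm_average_pow_le (hw s) n
    have h2 : ‖(w ⁻¹' {1}).indicator (fun _ => (1 : ℂ)) s‖ ≤ 1 := by
      by_cases hs : s ∈ w ⁻¹' {1} <;> simp only [Set.indicator_of_mem, hs,
        Set.indicator_of_notMem, not_false_eq_true, norm_one, norm_zero, le_refl, zero_le_one]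
    linarith
  · have h1 := (Complex.tendsto_average_pow (hw s)).sub_const
      ((w ⁻¹' {1}).indicator (fun _ => (1 : ℂ)) s)
    convert h1 using 2
    by_cases hs : w s = 1 <;> simp [hs]

/-- This makes `E(Ω)` independent of the Borel representative: `A \ B` and `B \ A` lie in the
resolvent set, where `E` vanishes. -/
theorem apply_preimage_congr (hμ : μ.IsEquicontinuous) (hf : Measurable f)
    (hU : μ.HasIntegral f U) {A B : Set ℂ} (hA : MeasurableSet A) (hB : MeasurableSet B)
    (hAB : A ∩ lcSpectrum U = B ∩ lcSpectrum U) : μ (f ⁻¹' A) = μ (f ⁻¹' B) := by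
  have key {A B : Set ℂ} (hA : MeasurableSet A) (hB : MeasurableSet B)
      (hAB : A ∩ lcSpectrum U = B ∩ lcSpectrum U) : μ (f ⁻¹' A) = μ (f ⁻¹' (A ∩ B)) := by
    have h0 : μ (f ⁻¹' (A \ B)) = 0 := by
      refine apply_preimage_eq_zero hμ hf hU (hA.diff hB) fun z hz => ?_
      by_contra hzU
      exact hz.2 (hAB.subset ⟨hz.1, hzU⟩).1
    rw [← Set.inter_union_sdiff A B, Set.preimage_union, μ.apply_union (hf (hA.inter hB))
      (hf (hA.diff hB)) (Set.disjoint_sdiff_inter.symm.preimage f), h0, add_zero,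
      Set.inter_union_sdiff]
  rw [key hA hB hAB, key hB hA hAB.symm, Set.inter_comm]

end SpectralMeasure

/-! ### The inverse GLA formula. -/

theorem mainTheorem2
    {F Γ S : Type*} [AddCommGroup F] [Module ℂ F] [TopologicalSpace F]
    [IsTopologicalAddGroup F] [ContinuousSMul ℂ F] [T2Space F]
    [TopologicalSpace.SeparableSpace F]
    (p : SeminormFamily ℂ F Γ) (hp : WithSeminorms p)
    (hF : LocallySeqWeaklyCompact F)
    [MeasurableSpace S] (μ : SpectralMeasure S F) (hμ : μ.IsEquicontinuous)
    (f : S → ℂ) (hf : Measurable f) (hfb : ∃ M : ℝ, ∀ s, ‖f s‖ ≤ M)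
    (U : F →L[ℂ] F) (hU : μ.HasIntegral f U)
    (hmin : HasMinimalPointSpectrum U)
    (hcirc : PointSpectrumOnIsolatedCircles f U)
    (C : ℝ) (hC : 0 < C⁻¹) (hspec : ∀ ξ ∈ lcSpectrum U, C⁻¹ ≤ ‖ξ‖)
    (l : ℂ) (hl : l ∈ pointSpectrum U) :
    U.IsInvertible ∧
      ∀ B : Set ℂ, MeasurableSet B →
        B ∩ lcSpectrum U = {ξ ∈ lcSpectrum U | ‖ξ‖ < ‖l‖} →
        ∀ x : F,
          Tendsto
            (fun n : ℕ => averageOp n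
              (l • (U.inverse ∘L (ContinuousLinearMap.id ℂ F - μ.map f hf B))) x)
            atTop (𝓝 (μ.map f hf {l} x)) := by
  have : PolynormableSpace ℂ F := hp.toPolynormableSpace
  have hres : Metric.ball 0 C⁻¹ ⊆ lcResolventSet U := fun ξ hξ => by
    by_contra h
    exact absurd (mem_ball_zero_iff.1 hξ) (not_lt.2 (hspec ξ h))
  have hμc : μ {s | C⁻¹ ≤ ‖f s‖} = ContinuousLinearMap.id ℂ F := by
    have e : {s | C⁻¹ ≤ ‖f s‖} = (f ⁻¹' Metric.ball 0 C⁻¹)ᶜ := by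
      ext s
      simp
    rw [e, μ.apply_compl (hf Metric.isOpen_ball.measurableSet),
      SpectralMeasure.apply_preimage_eq_zero hμ hf hU Metric.isOpen_ball.measurableSet hres,
      sub_zero]
  have hemb : IsEmbedding U := by
    -- At `ξ = 0` the shifted operator is `-U`, so the sign has to be undone.
    have h := (Homeomorph.neg F).isEmbedding.comp (hres (Metric.mem_ball_self hC)).2
    convert h using 1
    ext x
    simp [shiftedOp]
  have hinv : U.IsInvertible := ContinuousLinearMap.isInvertible_of_isEmbedding hemb
    (SpectralMeasure.surjective_of_hasIntegral hF hμ hf hU hC hμc)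
  refine ⟨hinv, fun B hB hBl x => ?_⟩
  have hlC : C⁻¹ ≤ ‖l‖ := hspec l hl.1
  have hlpos : 0 < ‖l‖ := hC.trans_le hlC
  have hBall : MeasurableSet (Metric.ball (0 : ℂ) ‖l‖) := Metric.isOpen_ball.measurableSet
  have hEB : μ.map f hf B = μ (f ⁻¹' Metric.ball 0 ‖l‖) := by
    refine SpectralMeasure.apply_preimage_congr hμ hf hU hB hBall (hBl.trans ?_)
    ext z
    simp [and_comm]
  rw [hEB, ← μ.apply_compl (hf hBall)]
  -- The integrand in the product form of the functional calculus. Since `C⁻¹ ≤ ‖l‖`, the cutoff at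
  -- `‖l‖` makes the one at `C⁻¹` redundant.
  set w : S → ℂ := fun s => l * ({s | C⁻¹ ≤ ‖f s‖}.indicator (fun s => (f s)⁻¹) s *
    (f ⁻¹' Metric.ball 0 ‖l‖)ᶜ.indicator (fun _ => 1) s)
  have hV := (((SpectralMeasure.hasIntegral_inverse hμ hf hU hC hμc hinv).mul hμ
    (μ.hasIntegral_indicator_one (hf hBall).compl)).const_mul hμ l)
  have hw (s : S) : w s = if ‖l‖ ≤ ‖f s‖ then l / f s else 0 := by
    by_cases hs : ‖l‖ ≤ ‖f s‖
    · have h1 : s ∈ {s | C⁻¹ ≤ ‖f s‖} := hlC.trans hs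
      have h2 : s ∈ (f ⁻¹' Metric.ball 0 ‖l‖)ᶜ := by simpa using hs
      simp only [w, Set.indicator_of_mem h1, Set.indicator_of_mem h2, if_pos hs, mul_one,
        div_eq_mul_inv]
    · have h2 : s ∉ (f ⁻¹' Metric.ball 0 ‖l‖)ᶜ := by simpa using hs
      simp only [w, Set.indicator_of_notMem h2, if_neg hs, mul_zero]
  have hwm : Measurable w := ((SpectralMeasure.measurable_indicator_inv hf C⁻¹).mul
    (measurable_const.indicator (hf hBall).compl)).const_mul l
  have hw1 (s : S) : ‖w s‖ ≤ 1 := by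
    rw [hw]
    split_ifs with hs
    · rw [norm_div]
      exact div_le_one_of_le₀ hs (norm_nonneg _)
    · simp
  have hpre : w ⁻¹' {1} = f ⁻¹' {l} := by
    ext s
    simp only [Set.mem_preimage, Set.mem_singleton_iff, hw]
    split_ifs with hs
    · have h0 : f s ≠ 0 := norm_pos_iff.1 (hlpos.trans_le hs)
      rw [div_eq_one_iff_eq h0, eq_comm]
    · refine ⟨fun h => absurd h zero_ne_one, fun h => absurd (h ▸ le_rfl) hs⟩
  have := SpectralMeasure.tendsto_averageOp hμ hwm hw1 hV x
  rwa [hpre] at this
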